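/- Let $J$ be a semi-infinite complex Jacobi matrix with diagonal entries $b_k$, entries $c_k$ in position $(k,k+1)$ and $a_k$ in position $(k+1,k)$, $k\ge 0$, where $a_k\to\frac12$, $c_k\to\frac12$, $b_k\to 0$; let $J_0$ be the one with $a_k=c_k=\frac12$, $b_k=0$, both regarded as bounded operators on $\ell^2(\mathbb Z_+)$. For $r\in\mathbb N$ put $$M_r:=\sum_{k=0}^\infty (k+1)^r\Big\{\big|a_k-\tfrac12\big|+|b_k|+\big|c_k-\tfrac12\big|\Big\}.$$ For $0<|z|<1$ let $\lambda(z)=\frac12(z+z^{-1})$ and let $\Delta(z,J)=\det\big[(J-\lambda(z))(J_0-\lambda(z))^{-1}\big]$ be the perturbation determinant (the Fredholm determinant on $\ell^2(\mathbb Z_+)$, i.e. the limit of the determinants of the leading finite sections of this operator), with $\Delta(0,J)$ defined by the limit $z\to0$. Let $W_+$ be the space of functions $\sum_{j\ge0}\delta_jz^j$ on $\overline{\mathbb D}=\{|z|\le1\}$ with $\sum_j|\delta_j|<\infty$. Then there is a constant $C(J)>0$, depending only on $J$, such that for every integer $n\ge 0$ with $M_{n+1}<\infty$ the following holds. The function $\Delta(\cdot,J)$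 is well defined and holomorphic in $\mathbb D=\{|z|<1\}$; its $n$-th derivative $\Delta^{(n)}$, extended by continuity to $\overline{\mathbb D}$, belongs to $W_+$; and, except in the trivial case $n=0$, $J=J_0$ (where $\Delta\equiv1$ and $M_1=0$), $$\max_{z\in\overline{\mathbb D}}\big|\Delta^{(n)}(z)\big|\le C(J)\,\frac{4^n}{n+1}\,M_{n+1}.$$ -/

import Mathlib

open Filter Topology

/-- The complex Hilbert space `ℓ²(ℤ₊)`. -/
abbrev EllTwo : Type := lp (fun _ : ℕ => ℂ) 2

/-- A semi-infinite complex Jacobi matrix, with `b k` on the diagonal, `a k` in row `k + 1`, column `k`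
and `c k` in row `k`, column `k + 1`, which is asymptotic to the discrete Laplacian:
`a k → 1/2`, `c k → 1/2`, `b k → 0`. -/
@[ext]
structure JacobiMatrix where
  a : ℕ → ℂ
  b : ℕ → ℂ
  c : ℕ → ℂ
  tendsto_a : Tendsto a atTop (𝓝 (1 / 2))
  tendsto_b : Tendsto b atTop (𝓝 0)
  tendsto_c : Tendsto c atTop (𝓝 (1 / 2))

namespace JacobiMatrix

/-- The discrete Laplacian `J₀`. -/
noncomputable def free : JacobiMatrix where
  a := fun _ => 1 / 2
  b := fun _ => 0
  c := fun _ => 1 / 2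
  tendsto_a := tendsto_const_nhds
  tendsto_b := tendsto_const_nhds
  tendsto_c := tendsto_const_nhds

/-- Formal action of a Jacobi matrix on a sequence:
`(J x)_k = a_{k-1} x_{k-1} + b_k x_k + c_k x_{k+1}`, without the first term for `k = 0`. -/
def action (J : JacobiMatrix) (x : ℕ → ℂ) : ℕ → ℂ
  | 0 => J.b 0 * x 0 + J.c 0 * x 1
  | k + 1 => J.a k * x k + J.b (k + 1) * x (k + 1) + J.c (k + 1) * x (k + 2)

theorem memlp_mul_of_tendsto {u : ℕ → ℂ} {l : ℂ} (hu : Tendsto u atTop (𝓝 l)) {x : ℕ → ℂ}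
    (hx : Memℓp x 2) : Memℓp (fun k => u k * x k) 2 := by
  obtain ⟨K, hK⟩ := (Metric.isBounded_range_of_tendsto u hu).exists_norm_le
  have h0 : 0 < (2 : ENNReal).toReal := by norm_num
  rw [memℓp_gen_iff h0] at hx ⊢
  refine Summable.of_nonneg_of_le (fun k => by positivity) (fun k => ?_)
    (hx.mul_left (K ^ (2 : ENNReal).toReal))
  have hk : ‖u k‖ ≤ K := hK _ ⟨k, rfl⟩
  rw [norm_mul, Real.mul_rpow (norm_nonneg _) (norm_nonneg _)]
  gcongr

theorem memlp_shift_iff {x : ℕ → ℂ} : Memℓp (fun k => x (k + 1)) 2 ↔ Memℓp x 2 := by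
  have h0 : 0 < (2 : ENNReal).toReal := by norm_num
  rw [memℓp_gen_iff h0, memℓp_gen_iff h0]
  exact summable_nat_add_iff (f := fun k => ‖x k‖ ^ (2 : ENNReal).toReal) 1

theorem memlp_action (J : JacobiMatrix) {x : ℕ → ℂ} (hx : Memℓp x 2) : Memℓp (J.action x) 2 := by
  rw [← memlp_shift_iff]
  have hb := memlp_shift_iff.2 (memlp_mul_of_tendsto J.tendsto_b hx)
  have hc := memlp_shift_iff.2 (memlp_mul_of_tendsto J.tendsto_c (memlp_shift_iff.2 hx))
  exact ((memlp_mul_of_tendsto J.tendsto_a hx).add hb).add hc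

/-- The linear map of `ℓ²(ℤ₊)` generated by a Jacobi matrix. -/
def linearOp (J : JacobiMatrix) : EllTwo →ₗ[ℂ] EllTwo where
  toFun x := ⟨J.action x, J.memlp_action (lp.memℓp x)⟩
  map_add' x y := by
    ext k
    change J.action (⇑x + ⇑y) k = J.action x k + J.action y k
    cases k <;> simp [action] <;> ring
  map_smul' r x := by
    ext k
    change J.action (r • ⇑x) k = r * J.action x k
    cases k <;> simp [action] <;> ring

theorem continuous_linearOp (J : JacobiMatrix) : Continuous J.linearOp := by
  refine J.linearOp.continuous_of_seq_closed_graph fun u x y hu hy => ?_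
  have hcoe : ∀ {v : ℕ → EllTwo} {w : EllTwo}, Tendsto v atTop (𝓝 w) →
      ∀ k, Tendsto (fun n => v n k) atTop (𝓝 (w k)) := fun {v w} h k =>
    ((continuous_apply k).tendsto _).comp ((lp.uniformContinuous_coe.continuous.tendsto _).comp h)
  ext k
  refine tendsto_nhds_unique (hcoe hy k) ?_
  cases k with
  | zero => exact ((hcoe hu 0).const_mul _).add ((hcoe hu 1).const_mul _)
  | succ k =>
    exact (((hcoe hu k).const_mul _).add ((hcoe hu (k + 1)).const_mul _)).add
      ((hcoe hu (k + 2)).const_mul _)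

/-- The bounded operator of `ℓ²(ℤ₊)` generated by a Jacobi matrix. -/
def op (J : JacobiMatrix) : EllTwo →L[ℂ] EllTwo := ⟨J.linearOp, J.continuous_linearOp⟩

/-- The size of the perturbation of the `k`-th entries. -/
noncomputable def deviation (J : JacobiMatrix) (k : ℕ) : ℝ :=
  ‖J.a k - 1 / 2‖ + ‖J.b k‖ + ‖J.c k - 1 / 2‖

/-- The moment of order `r` of the entry perturbations is finite. -/
def FiniteMoment (J : JacobiMatrix) (r : ℕ) : Prop :=
  Summable fun k : ℕ => ((k : ℝ) + 1) ^ r * J.deviation k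

/-- The moment `M_r` of order `r` of the entry perturbations (used only when it is finite). -/
noncomputable def moment (J : JacobiMatrix) (r : ℕ) : ℝ :=
  ∑' k : ℕ, ((k : ℝ) + 1) ^ r * J.deviation k

end JacobiMatrix

/-- The leading `m × m` section of the matrix of an operator of `ℓ²(ℤ₊)` in the standard basis. -/
noncomputable def leadingSection (T : EllTwo →L[ℂ] EllTwo) (m : ℕ) : Matrix (Fin m) (Fin m) ℂ :=
  Matrix.of fun i j => T (lp.single 2 (j : ℕ) (1 : ℂ)) (i : ℕ)

/-- `d` is the determinant of the operator `T` of `ℓ²(ℤ₊)`, for `T = I + A` with `A` of trace class.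
With `P_m` the projection to the first `m` basis vectors, the operators `P_m A P_m` have finite rank
and tend to `A` in trace norm, and the determinant of `I + A` is the limit of the finite
determinants of `I + P_m A P_m`, that is of the leading `m × m` sections of `T`. -/
def HasFredholmDet (T : EllTwo →L[ℂ] EllTwo) (d : ℂ) : Prop :=
  Tendsto (fun m => (leadingSection T m).det) atTop (𝓝 d)

/-- The determinant of the operator `T` of `ℓ²(ℤ₊)`; see `HasFredholmDet`. -/
noncomputable def fredholmDet (T : EllTwo →L[ℂ] EllTwo) : ℂ :=
  limUnder atTop fun m => (leadingSection T m).det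

/-- The Joukowski map `λ(z) = (z + z⁻¹) / 2`, for `z ≠ 0`. -/
noncomputable def joukowski (z : ℂ) : ℂ := (z + z⁻¹) / 2

namespace JacobiMatrix

/-- The operator `J - λ(z)`. -/
noncomputable def shifted (J : JacobiMatrix) (z : ℂ) : EllTwo →L[ℂ] EllTwo :=
  J.op - joukowski z • (1 : EllTwo →L[ℂ] EllTwo)

/-- The operator `(J - λ(z)) (J₀ - λ(z))⁻¹`, for `0 < |z| < 1`. -/
noncomputable def perturbationOp (J : JacobiMatrix) (z : ℂ) : EllTwo →L[ℂ] EllTwo :=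
  J.shifted z * Ring.inverse (free.shifted z)

/-- The perturbation determinant `Δ(z, J) = det (J - λ(z)) (J₀ - λ(z))⁻¹` on the open unit disk.
The point `z = 0`, which corresponds to `λ = ∞`, is filled in by the limit. Only the values on the
open disk are used. -/
noncomputable def perturbationDet (J : JacobiMatrix) : ℂ → ℂ :=
  Function.update (fun z => fredholmDet (J.perturbationOp z)) 0
    (limUnder (𝓝[≠] (0 : ℂ)) fun z => fredholmDet (J.perturbationOp z))

/-- The `n`-th derivative of the perturbation determinant as a function on the closed unit disk: the
derivative in the open disk, extended to the unit circle by continuity. -/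
noncomputable def perturbationDetDeriv (J : JacobiMatrix) (n : ℕ) : ℂ → ℂ :=
  extendFrom (Metric.ball 0 1) (iteratedDeriv n J.perturbationDet)

end JacobiMatrix

/-- The space `W₊`: functions on the closed unit disk that are sums of an absolutely convergent
Taylor series. -/
def MemWienerPlus (f : ℂ → ℂ) : Prop :=
  ∃ δ : ℕ → ℂ, Summable (fun j => ‖δ j‖) ∧
    ∀ z ∈ Metric.closedBall (0 : ℂ) 1, HasSum (fun j => δ j * z ^ j) (f z)

/-! The free operator factors as `J₀ - λ(z) = -(2z)⁻¹ (1 - zL)(1 - zR)`, with `L`, `R` the left and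
right shifts, so each column of its resolvent is geometric with ratio `z` from the diagonal
downwards. Hence truncating `(J - λ)(J₀ - λ)⁻¹` to size `m + 1` gives a product of truncations, in
which only the last diagonal entry of `J - λ` is corrected, by `c_m z`. The case `J = J₀` evaluates
the determinant of the resolvent factor as `(-2z)^(m+1)`, and `det_leadingSection` follows: the
section determinant is a polynomial `h_m(z)` plus an error of order `deviation m` times `p_m(z)`,
where `p_m = (-2z)^m det(J_m - λ)`.

The recurrence `h_(m+1) = h_m + ((1 - 4 a_m c_m) z² - 2 b_m z) p_m` makes the increments of `h_m`
proportional to `deviation m`. A discrete Gronwall argument (`coeffNorm_sectionPoly_le`) bounds the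
ℓ¹ coefficient norm of `p_m` by a constant times `m + 1`. Thus `M_1 < ∞` makes the error vanish and
`h_m` converge to `Δ`.

The `m`-th increment has degree at most `2(m + 1)`, so `n` derivatives cost at most `(2(m + 1))^n`.
Summing over `m` gives a constant times `2^n M_(n+1)`, and `2^n ≤ 4^n / (n + 1)`. For `n = 0` the
constant term `1` of `Δ` must also be absorbed, which is possible because `M_1 > 0` when `J ≠ J₀`.
-/

open Polynomial in
/-- The sum of the norms of the coefficients of a polynomial. -/
noncomputable def coeffNorm (p : ℂ[X]) : ℝ := ∑' j, ‖p.coeff j‖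

/-! ### The ℓ¹ coefficient norm of polynomials -/

section CoeffNorm

open Polynomial

theorem summable_norm_coeff (p : ℂ[X]) : Summable fun j => ‖p.coeff j‖ := by
  refine summable_of_hasFiniteSupport (p.support.finite_toSet.subset fun j hj => ?_)
  simpa using hj

theorem coeffNorm_nonneg (p : ℂ[X]) : 0 ≤ coeffNorm p := tsum_nonneg fun _ => norm_nonneg _

theorem coeffNorm_add_le (p q : ℂ[X]) : coeffNorm (p + q) ≤ coeffNorm p + coeffNorm q := by
  unfold coeffNorm
  rw [← (summable_norm_coeff p).tsum_add (summable_norm_coeff q)]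
  refine (summable_norm_coeff _).tsum_le_tsum (fun j => ?_)
    ((summable_norm_coeff p).add (summable_norm_coeff q))
  rw [coeff_add]
  exact norm_add_le _ _

theorem coeffNorm_C_mul (c : ℂ) (p : ℂ[X]) : coeffNorm (C c * p) = ‖c‖ * coeffNorm p := by
  simp [coeffNorm, tsum_mul_left]

/-- Shifting coefficients is isometric. With `coeffNorm_C_mul` this replaces submultiplicativity,
since the recurrences below only multiply by scalars and powers of `X`. -/
theorem coeffNorm_X_mul (p : ℂ[X]) : coeffNorm (X * p) = coeffNorm p := by
  unfold coeffNorm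
  rw [(summable_norm_coeff (X * p)).tsum_eq_zero_add]
  simp

theorem coeffNorm_one : coeffNorm 1 = 1 := by
  unfold coeffNorm
  rw [tsum_eq_single 0 fun j hj => by simp [coeff_one, hj]]
  simp

theorem norm_eval_le_coeffNorm (p : ℂ[X]) {z : ℂ} (hz : ‖z‖ ≤ 1) : ‖p.eval z‖ ≤ coeffNorm p := by
  rw [eval_eq_sum]
  refine (norm_sum_le _ _).trans ((Finset.sum_le_sum fun j _ => ?_).trans
    ((summable_norm_coeff p).sum_le_tsum p.support fun _ _ => norm_nonneg _))
  rw [norm_mul, norm_pow]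
  exact mul_le_of_le_one_right (norm_nonneg _) (pow_le_one₀ (norm_nonneg _) hz)

theorem hasSum_eval (p : ℂ[X]) (z : ℂ) : HasSum (fun j => p.coeff j * z ^ j) (p.eval z) := by
  rw [eval_eq_sum]
  exact hasSum_sum_of_ne_finset_zero fun j hj => by simp [notMem_support_iff.1 hj]

theorem summable_weighted_norm_coeff (p : ℂ[X]) (w : ℕ → ℝ) :
    Summable fun j => w j * ‖p.coeff j‖ := by
  refine summable_of_hasFiniteSupport (p.support.finite_toSet.subset fun j hj => ?_)
  simp only [Function.mem_support, ne_eq, mul_eq_zero, norm_eq_zero, not_or] at hj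
  simpa using hj.2

/-- A weighted coefficient sum, for a weight bounded by `W` up to the degree. -/
theorem tsum_weighted_norm_coeff_le (p : ℂ[X]) {w : ℕ → ℝ} {W : ℝ} {N : ℕ}
    (hp : p.natDegree ≤ N) (hw : ∀ j ≤ N, w j ≤ W) :
    ∑' j, w j * ‖p.coeff j‖ ≤ W * coeffNorm p := by
  unfold coeffNorm
  rw [← tsum_mul_left]
  refine (summable_weighted_norm_coeff p w).tsum_le_tsum (fun j => ?_)
    ((summable_norm_coeff p).mul_left W)
  rcases le_or_gt j N with hj | hj
  · exact mul_le_mul_of_nonneg_right (hw j hj) (norm_nonneg _)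
  · simp [coeff_eq_zero_of_natDegree_lt (hp.trans_lt hj)]

end CoeffNorm

/-! ### Termwise differentiation and boundary extension of power series -/

section PowerSeries

variable {δ : ℕ → ℂ} {f : ℂ → ℂ}

theorem summable_descFactorial_of_le {n k : ℕ} (hk : k ≤ n)
    (h : Summable fun j => (j.descFactorial n : ℝ) * ‖δ j‖) :
    Summable fun j => (j.descFactorial k : ℝ) * ‖δ j‖ := by
  -- The first `n` terms are dropped: there `j.descFactorial n` vanishes and dominates nothing,
  -- while from `n` on it is a positive integer multiple of `j.descFactorial k`.
  rw [← summable_nat_add_iff n] at h ⊢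
  refine Summable.of_nonneg_of_le (fun j => by positivity) (fun j => ?_) h
  refine mul_le_mul_of_nonneg_right ?_ (norm_nonneg _)
  have h1 : (j + n).descFactorial n = (j + n - k).descFactorial (n - k) * (j + n).descFactorial k :=
    (Nat.descFactorial_mul_descFactorial hk).symm
  have h2 : 1 ≤ (j + n - k).descFactorial (n - k) :=
    Nat.succ_le_of_lt (Nat.descFactorial_pos.2 (by omega))
  exact_mod_cast h1 ▸ Nat.le_mul_of_pos_left _ h2

/-- Termwise differentiation, up to order `n`, in the open unit disk of a power series whose
coefficients have a finite moment of order `n`. -/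
theorem hasSum_iteratedDeriv {n : ℕ} (h : Summable fun j => (j.descFactorial n : ℝ) * ‖δ j‖)
    (hf : ∀ z ∈ Metric.ball (0 : ℂ) 1, HasSum (fun j => δ j * z ^ j) (f z)) :
    ∀ k ≤ n, ∀ z ∈ Metric.ball (0 : ℂ) 1,
      HasSum (fun j => j.descFactorial k * δ j * z ^ (j - k)) (iteratedDeriv k f z) := by
  intro k
  induction k with
  | zero => intro _ z hz; simpa using hf z hz
  | succ k ih =>
    intro hk z hz
    have ih := ih (by omega)
    have hs := summable_descFactorial_of_le (by omega : k ≤ n) h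
    have key := Complex.hasSum_deriv_of_summable_norm
      (F := fun j w => j.descFactorial k * δ j * w ^ (j - k)) hs
      (fun j => ((differentiable_id.pow (j - k)).const_mul _).differentiableOn)
      Metric.isOpen_ball (fun j w hw => ?_) hz
    · have e1 : deriv (fun w => ∑' j, (j.descFactorial k : ℂ) * δ j * w ^ (j - k)) z
          = iteratedDeriv (k + 1) f z := by
        rw [iteratedDeriv_succ]
        refine Filter.EventuallyEq.deriv_eq ?_
        filter_upwards [Metric.isOpen_ball.mem_nhds hz] with w hw
        exact (ih w hw).tsum_eq
      rw [e1] at key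
      convert! key using 2 with j
      -- The truncated exponent `j - k` is harmless: for `j < k` the factor `j.descFactorial k` is
      -- zero.
      rw [deriv_const_mul_field, deriv_pow_field, Nat.descFactorial_succ, Nat.sub_sub]
      push_cast
      ring
    · rw [norm_mul, norm_mul, norm_pow, Complex.norm_natCast]
      exact mul_le_of_le_one_right (by positivity)
        (pow_le_one₀ (norm_nonneg _) (mem_ball_zero_iff.1 hw).le)

theorem differentiableOn_ball_of_hasSum (h : Summable fun j => ‖δ j‖)
    (hf : ∀ z ∈ Metric.ball (0 : ℂ) 1, HasSum (fun j => δ j * z ^ j) (f z)) :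
    DifferentiableOn ℂ f (Metric.ball 0 1) := by
  have key := Complex.differentiableOn_tsum_of_summable_norm
      (F := fun j w => δ j * w ^ j) h
      (fun j => ((differentiable_id.pow j).const_mul _).differentiableOn)
      (Metric.isOpen_ball (x := (0 : ℂ)) (ε := 1)) (fun j w hw => ?_)
  · exact key.congr fun z hz => (hf z hz).tsum_eq.symm
  · rw [norm_mul, norm_pow]
    exact mul_le_of_le_one_right (by positivity)
      (pow_le_one₀ (norm_nonneg _) (mem_ball_zero_iff.1 hw).le)

theorem hasSum_closedBall {w : ℕ → ℂ} (hw : Summable fun j => ‖w j‖) (e : ℕ → ℕ) {z : ℂ}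
    (hz : z ∈ Metric.closedBall (0 : ℂ) 1) :
    HasSum (fun j => w j * z ^ e j) (∑' j, w j * z ^ e j) := by
  refine (Summable.of_norm_bounded hw fun j => ?_).hasSum
  rw [norm_mul, norm_pow]
  exact mul_le_of_le_one_right (by positivity)
    (pow_le_one₀ (norm_nonneg _) (mem_closedBall_zero_iff.1 hz))

/-- The differentiated series converges uniformly on the closed disk, so its sum is continuous there
and is the continuous extension of the derivative. -/
theorem hasSum_extendFrom_iteratedDeriv {n : ℕ}
    (h : Summable fun j => (j.descFactorial n : ℝ) * ‖δ j‖)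
    (hf : ∀ z ∈ Metric.ball (0 : ℂ) 1, HasSum (fun j => δ j * z ^ j) (f z))
    {z : ℂ} (hz : z ∈ Metric.closedBall (0 : ℂ) 1) :
    HasSum (fun j => j.descFactorial n * δ j * z ^ (j - n))
      (extendFrom (Metric.ball 0 1) (iteratedDeriv n f) z) := by
  have h' : Summable fun j => ‖(j.descFactorial n : ℂ) * δ j‖ := by simpa using h
  have hc : ContinuousOn (fun w => ∑' j, (j.descFactorial n : ℂ) * δ j * w ^ (j - n))
      (Metric.closedBall 0 1) := by
    refine continuousOn_tsum (fun j => by fun_prop) h' fun j w hw => ?_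
    rw [norm_mul _ (w ^ _), norm_pow]
    exact mul_le_of_le_one_right (by positivity)
      (pow_le_one₀ (norm_nonneg _) (mem_closedBall_zero_iff.1 hw))
  have e : extendFrom (Metric.ball 0 1) (iteratedDeriv n f) z
      = ∑' j, (j.descFactorial n : ℂ) * δ j * z ^ (j - n) := by
    refine extendFrom_eq (by rwa [closure_ball _ one_ne_zero]) ?_
    refine Tendsto.congr' ?_ ((hc z hz).mono_left (nhdsWithin_mono _ Metric.ball_subset_closedBall))
    filter_upwards [self_mem_nhdsWithin] with w hw
    exact (hasSum_iteratedDeriv h hf n le_rfl w hw).tsum_eq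
  rw [e]
  exact hasSum_closedBall h' _ hz

theorem memWienerPlus_extendFrom_iteratedDeriv {n : ℕ}
    (h : Summable fun j => (j.descFactorial n : ℝ) * ‖δ j‖)
    (hf : ∀ z ∈ Metric.ball (0 : ℂ) 1, HasSum (fun j => δ j * z ^ j) (f z)) :
    MemWienerPlus (extendFrom (Metric.ball 0 1) (iteratedDeriv n f)) := by
  refine ⟨fun j => (j + n).descFactorial n * δ (j + n), ?_, fun z hz => ?_⟩
  · simpa using (summable_nat_add_iff n).2 h
  · have := (hasSum_nat_add_iff' n).2 (hasSum_extendFrom_iteratedDeriv h hf hz)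
    rw [Finset.sum_eq_zero fun j hj => by
      rw [Nat.descFactorial_of_lt (Finset.mem_range.1 hj)]; simp, sub_zero] at this
    simpa using this

theorem norm_extendFrom_iteratedDeriv_le {n : ℕ}
    (h : Summable fun j => (j.descFactorial n : ℝ) * ‖δ j‖)
    (hf : ∀ z ∈ Metric.ball (0 : ℂ) 1, HasSum (fun j => δ j * z ^ j) (f z))
    {z : ℂ} (hz : z ∈ Metric.closedBall (0 : ℂ) 1) :
    ‖extendFrom (Metric.ball 0 1) (iteratedDeriv n f) z‖
      ≤ ∑' j, (j.descFactorial n : ℝ) * ‖δ j‖ := by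
  rw [← (hasSum_extendFrom_iteratedDeriv h hf hz).tsum_eq]
  refine tsum_of_norm_bounded h.hasSum fun j => ?_
  rw [norm_mul, norm_mul, norm_pow, Complex.norm_natCast]
  exact mul_le_of_le_one_right (by positivity)
    (pow_le_one₀ (norm_nonneg _) (mem_closedBall_zero_iff.1 hz))

end PowerSeries

/-! ### Shift operators on ℓ² -/

namespace EllTwo

/-- The sequence `0, x 0, x 1, …`. -/
def delay (x : ℕ → ℂ) : ℕ → ℂ
  | 0 => 0
  | k + 1 => x k

theorem norm_sq_eq_tsum (x : EllTwo) : ‖x‖ ^ 2 = ∑' k, ‖x k‖ ^ 2 := by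
  have := lp.norm_rpow_eq_tsum (p := 2) (by norm_num) x
  simpa using this

theorem summable_norm_sq (x : EllTwo) : Summable fun k => ‖x k‖ ^ 2 := by
  have := (memℓp_gen_iff (p := 2) (by norm_num)).1 (lp.memℓp x)
  simpa using this

theorem norm_le_of_sq_le {x y : EllTwo} (h : ‖x‖ ^ 2 ≤ ‖y‖ ^ 2) : ‖x‖ ≤ 1 * ‖y‖ := by
  rw [one_mul]
  exact le_of_sq_le_sq h (norm_nonneg _)

/-- The right shift `(x₀, x₁, …) ↦ (0, x₀, x₁, …)` of `ℓ²(ℤ₊)`. -/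
noncomputable def rightShift : EllTwo →L[ℂ] EllTwo :=
  LinearMap.mkContinuous
    { toFun := fun x => ⟨delay x, JacobiMatrix.memlp_shift_iff.1 (lp.memℓp x)⟩
      map_add' := fun x y => by
        ext k
        change delay (⇑x + ⇑y) k = delay x k + delay y k
        cases k <;> simp [delay]
      map_smul' := fun r x => by
        ext k
        change delay (r • ⇑x) k = r * delay x k
        cases k <;> simp [delay] } 1 fun x => norm_le_of_sq_le <| by
      rw [norm_sq_eq_tsum, norm_sq_eq_tsum, (summable_norm_sq _).tsum_eq_zero_add]
      simp [delay]

/-- The left shift `(x₀, x₁, …) ↦ (x₁, x₂, …)` of `ℓ²(ℤ₊)`. -/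
noncomputable def leftShift : EllTwo →L[ℂ] EllTwo :=
  LinearMap.mkContinuous
    { toFun := fun x => ⟨fun k => x (k + 1), JacobiMatrix.memlp_shift_iff.2 (lp.memℓp x)⟩
      map_add' := fun x y => rfl
      map_smul' := fun r x => rfl } 1 fun x => norm_le_of_sq_le <| by
      rw [norm_sq_eq_tsum, norm_sq_eq_tsum, (summable_norm_sq x).tsum_eq_zero_add]
      exact le_add_of_nonneg_left (sq_nonneg _)

@[simp] theorem rightShift_zero (x : EllTwo) : rightShift x 0 = 0 := rfl

@[simp] theorem rightShift_succ (x : EllTwo) (k : ℕ) : rightShift x (k + 1) = x k := rfl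

theorem norm_rightShift_le : ‖rightShift‖ ≤ 1 := LinearMap.mkContinuous_norm_le _ zero_le_one _

theorem norm_leftShift_le : ‖leftShift‖ ≤ 1 := LinearMap.mkContinuous_norm_le _ zero_le_one _

theorem isUnit_one_sub_smul {T : EllTwo →L[ℂ] EllTwo} (hT : ‖T‖ ≤ 1) {z : ℂ} (hz : ‖z‖ < 1) :
    IsUnit (1 - z • T) := by
  refine isUnit_one_sub_of_norm_lt_one ?_
  rw [norm_smul]
  exact (mul_le_of_le_one_right (norm_nonneg _) hT).trans_lt hz

end EllTwo

/-! ### The resolvent of the free operator -/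

namespace JacobiMatrix

open EllTwo

theorem shifted_apply (J : JacobiMatrix) (z : ℂ) (x : EllTwo) (k : ℕ) :
    J.shifted z x k = J.action x k - joukowski z * x k := rfl

/-- Rests on `L R = 1`. The order of the factors matters, since `R L ≠ 1`. -/
theorem free_shifted_eq {z : ℂ} (hz : z ≠ 0) :
    free.shifted z = (-(2 * z)⁻¹) • ((1 - z • leftShift) * (1 - z • rightShift)) := by
  ext x k
  change free.shifted z x k = -(2 * z)⁻¹ *
    ((x k - z * rightShift x k) - z * (x (k + 1) - z * rightShift x (k + 1)))
  rw [shifted_apply]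
  cases k <;> simp [action, free, joukowski] <;> field_simp <;> ring

theorem isUnit_free_shifted {z : ℂ} (hz : z ≠ 0) (hz1 : ‖z‖ < 1) : IsUnit (free.shifted z) := by
  rw [free_shifted_eq hz]
  have h : IsUnit (-(2 * z)⁻¹) := by simp [hz]
  have := (isUnit_one_sub_smul norm_leftShift_le hz1).mul
    (isUnit_one_sub_smul norm_rightShift_le hz1)
  exact (h.map (algebraMap ℂ (EllTwo →L[ℂ] EllTwo))).mul this |> fun H => by
    rwa [← Algebra.smul_def] at H

/-- A column of the resolvent of `J₀`. -/
noncomputable def freeColumn (z : ℂ) (j : ℕ) : EllTwo :=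
  Ring.inverse (free.shifted z) (lp.single 2 j (1 : ℂ))

theorem free_shifted_freeColumn {z : ℂ} (hz : z ≠ 0) (hz1 : ‖z‖ < 1) (j : ℕ) :
    free.shifted z (freeColumn z j) = lp.single 2 j (1 : ℂ) := by
  have h := Ring.mul_inverse_cancel _ (isUnit_free_shifted hz hz1)
  exact congrArg (fun T : EllTwo →L[ℂ] EllTwo => T (lp.single 2 j (1 : ℂ))) h

/-- Below the diagonal, the columns of the resolvent of `J₀` are geometric with ratio `z`. -/
theorem freeColumn_succ {z : ℂ} (hz : z ≠ 0) (hz1 : ‖z‖ < 1) {j m : ℕ} (hjm : j ≤ m) :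
    freeColumn z j (m + 1) = z * freeColumn z j m := by
  set x := freeColumn z j with hx
  set w : EllTwo := (1 - z • rightShift) x with hw
  have hwk : ∀ k, w (k + 1) = x (k + 1) - z * x k := fun k => rfl
  have key : ∀ i, j < i → w i = z * w (i + 1) := by
    intro i hi
    have h1 : (-(2 * z)⁻¹) * (w i - z * w (i + 1)) = (lp.single 2 j (1 : ℂ) : EllTwo) i := by
      rw [← free_shifted_freeColumn hz hz1 j, free_shifted_eq hz]
      rfl
    rw [lp.single_apply_ne _ _ _ hi.ne'] at h1
    have h2 : -(2 * z)⁻¹ ≠ 0 := by simp [hz]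
    exact sub_eq_zero.1 ((mul_eq_zero.1 h1).resolve_left h2)
  -- Beyond row `j`, `w` solves a recurrence whose nonzero solutions grow like `z⁻ⁿ`; boundedness of
  -- `w` forces it to vanish there.
  have hpow : ∀ n, w (m + 1) = z ^ n * w (m + 1 + n) := by
    intro n
    induction n with
    | zero => simp
    | succ n ih => rw [ih, key (m + 1 + n) (by omega), pow_succ]; ring_nf
  have hlim : Tendsto (fun n => ‖z‖ ^ n * ‖w‖) atTop (𝓝 (0 * ‖w‖)) :=
    (tendsto_pow_atTop_nhds_zero_of_lt_one (norm_nonneg _) hz1).mul_const _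
  have h0 : ‖w (m + 1)‖ ≤ 0 * ‖w‖ := by
    refine ge_of_tendsto' hlim fun n => ?_
    rw [hpow n, norm_mul, norm_pow]
    exact mul_le_mul_of_nonneg_left (lp.norm_apply_le_norm two_ne_zero w _) (by positivity)
  rw [zero_mul, norm_le_zero_iff, hwk, sub_eq_zero] at h0
  exact h0

end JacobiMatrix

/-! ### Determinants of tridiagonal matrices -/

/-- The tridiagonal `m × m` matrix with diagonal `β`, lower diagonal `α`, upper diagonal `γ`. -/
def tridiagonal (β α γ : ℕ → ℂ) (m : ℕ) : Matrix (Fin m) (Fin m) ℂ :=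
  Matrix.of fun i j =>
    if (j : ℕ) = i then β i else if (j : ℕ) + 1 = i then α j else if (j : ℕ) = i + 1 then γ i else 0

section Tridiagonal

variable (β α γ : ℕ → ℂ)

theorem tridiagonal_congr {β β' : ℕ → ℂ} {m : ℕ} (h : ∀ k < m, β k = β' k) :
    tridiagonal β α γ m = tridiagonal β' α γ m := by
  ext i j
  simp only [tridiagonal, Matrix.of_apply, h i i.isLt]

theorem det_tridiagonal_one : (tridiagonal β α γ 1).det = β 0 := by
  simp [tridiagonal]

/-- Expansion along the last row. The minor of the entry `α m` has `γ m` as the only nonzero entry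
of its last column, so a second expansion finishes. -/
theorem det_tridiagonal_succ_succ (m : ℕ) :
    (tridiagonal β α γ (m + 2)).det = β (m + 1) * (tridiagonal β α γ (m + 1)).det
      - α m * γ m * (tridiagonal β α γ m).det := by
  have hlast : (Fin.last m).castSucc.succAbove (Fin.last m) = Fin.last (m + 1) := by
    rw [Fin.succAbove_castSucc_self]
    rfl
  have hB : ((tridiagonal β α γ (m + 2)).submatrix Fin.castSucc
      (Fin.last m).castSucc.succAbove).det = γ m * (tridiagonal β α γ m).det := by
    rw [Matrix.det_succ_column _ (Fin.last m), Fin.sum_univ_castSucc,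
      Finset.sum_eq_zero, zero_add]
    · have h1 : (((tridiagonal β α γ (m + 2)).submatrix Fin.castSucc
          (Fin.last m).castSucc.succAbove).submatrix (Fin.last m).succAbove
          (Fin.last m).succAbove) = tridiagonal β α γ m := by
        ext i j
        have : (Fin.last m).castSucc.succAbove j.castSucc = j.castSucc.castSucc :=
          Fin.succAbove_of_castSucc_lt _ _ (by simp [Fin.lt_def])
        simp [tridiagonal, this]
      have h2 : (tridiagonal β α γ (m + 2)).submatrix Fin.castSucc
          (Fin.last m).castSucc.succAbove (Fin.last m) (Fin.last m) = γ m := by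
        simp [tridiagonal, hlast]
        omega
      rw [h1, h2, Even.neg_one_pow ⟨_, rfl⟩, one_mul]
    · intro i _
      have hi : (i : ℕ) < m := i.isLt
      have h0 : (tridiagonal β α γ (m + 2)).submatrix Fin.castSucc
          (Fin.last m).castSucc.succAbove i.castSucc (Fin.last m) = 0 := by
        simp only [tridiagonal, Matrix.submatrix_apply, Matrix.of_apply, hlast, Fin.val_last,
          Fin.val_castSucc]
        rw [if_neg (by omega), if_neg (by omega), if_neg (by omega)]
      rw [h0]
      ring
  rw [Matrix.det_succ_row _ (Fin.last (m + 1)), Fin.sum_univ_castSucc, Fin.sum_univ_castSucc,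
    Finset.sum_eq_zero, zero_add, Fin.succAbove_last, hB]
  · have h1 : (tridiagonal β α γ (m + 2)).submatrix Fin.castSucc Fin.castSucc
        = tridiagonal β α γ (m + 1) := by
      ext i j
      simp [tridiagonal]
    rw [h1]
    have h2 : tridiagonal β α γ (m + 2) (Fin.last (m + 1)) (Fin.last m).castSucc = α m := by
      simp [tridiagonal]
    have h3 : tridiagonal β α γ (m + 2) (Fin.last (m + 1)) (Fin.last (m + 1)) = β (m + 1) := by
      simp [tridiagonal]
    rw [h2, h3]
    have h4 : (-1 : ℂ) ^ ((Fin.last (m + 1) : ℕ) + ((Fin.last m).castSucc : ℕ)) = -1 := by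
      rw [Fin.val_last, Fin.val_castSucc, Fin.val_last]
      exact Odd.neg_one_pow ⟨m, by ring⟩
    have h5 : (-1 : ℂ) ^ ((Fin.last (m + 1) : ℕ) + (Fin.last (m + 1) : ℕ)) = 1 :=
      Even.neg_one_pow ⟨_, rfl⟩
    rw [h4, h5]
    ring
  · intro i _
    have : (i : ℕ) < m := i.isLt
    have h0 : tridiagonal β α γ (m + 2) (Fin.last (m + 1)) i.castSucc.castSucc = 0 := by
      simp only [tridiagonal, Matrix.of_apply, Fin.val_last, Fin.val_castSucc]
      rw [if_neg (by omega), if_neg (by omega), if_neg (by omega)]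
    rw [h0]
    ring

/-- Adding a term to the last diagonal entry. -/
theorem det_tridiagonal_update_last (m : ℕ) (t : ℂ) :
    (tridiagonal (Function.update β m (β m + t)) α γ (m + 1)).det
      = (tridiagonal β α γ (m + 1)).det + t * (tridiagonal β α γ m).det := by
  have h : ∀ l ≤ m, tridiagonal (Function.update β m (β m + t)) α γ l = tridiagonal β α γ l :=
    fun l hl => tridiagonal_congr _ _ fun k hk => Function.update_of_ne (by omega) _ _
  cases m with
  | zero => rw [det_tridiagonal_one, det_tridiagonal_one]; simp
  | succ m =>
    rw [det_tridiagonal_succ_succ, det_tridiagonal_succ_succ, h _ le_rfl, h m (by omega)]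
    simp
    ring

/-- The lower-diagonal term stays a sum because row `0` has no predecessor. -/
theorem tridiagonal_sum_mul (m : ℕ) (x : ℕ → ℂ) (i : Fin m) :
    ∑ k : Fin m, tridiagonal β α γ m i k * x k
      = (∑ k ∈ Finset.range m, if k + 1 = i then α k * x k else 0) + β i * x i
        + if (i : ℕ) + 1 < m then γ i * x (i + 1) else 0 := by
  have h : ∀ k : ℕ, (if k = (i : ℕ) then β i else if k + 1 = i then α k
      else if k = (i : ℕ) + 1 then γ i else 0) * x k
      = (if k + 1 = i then α k * x k else 0) + (if k = (i : ℕ) then β i * x i else 0)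
        + if k = (i : ℕ) + 1 then γ i * x (i + 1) else 0 := by
    intro k
    split_ifs <;> first | omega | simp_all
  have e := Fin.sum_univ_eq_sum_range (fun k : ℕ => (if k = (i : ℕ) then β i else if k + 1 = i
    then α k else if k = (i : ℕ) + 1 then γ i else 0) * x k) m
  simp only [tridiagonal, Matrix.of_apply]
  rw [e]
  simp only [h, Finset.sum_add_distrib, Finset.sum_ite_eq', Finset.mem_range, i.isLt, if_true]

end Tridiagonal

/-! ### Finite sections and their polynomials -/

namespace JacobiMatrix

/-- Only row `m` of `J` reaches outside the section, through `c_m` times entry `m + 1` of a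
resolvent column. Since `j ≤ m`, that entry is `z` times entry `m`, so the overflow folds into the
last diagonal entry. -/
theorem leadingSection_perturbationOp (J : JacobiMatrix) {z : ℂ} (hz : z ≠ 0) (hz1 : ‖z‖ < 1)
    (m : ℕ) :
    leadingSection (J.perturbationOp z) (m + 1)
      = tridiagonal (Function.update (fun k => J.b k - joukowski z) m
          (J.b m - joukowski z + J.c m * z)) J.a J.c (m + 1)
        * Matrix.of fun i j : Fin (m + 1) => freeColumn z j i := by
  ext i j
  have h0 : leadingSection (J.perturbationOp z) (m + 1) i j
      = J.action (freeColumn z j) i - joukowski z * freeColumn z j i := rfl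
  have hs := freeColumn_succ hz hz1 (Nat.lt_succ_iff.1 j.isLt)
  rw [h0, Matrix.mul_apply]
  simp only [Matrix.of_apply]
  rw [tridiagonal_sum_mul]
  obtain ⟨i, hi⟩ := i
  have hc : Function.update (fun k => J.b k - joukowski z) m
        (J.b m - joukowski z + J.c m * z) i * freeColumn z j i
      + (if i + 1 < m + 1 then J.c i * freeColumn z j (i + 1) else 0)
      = (J.b i - joukowski z) * freeColumn z j i + J.c i * freeColumn z j (i + 1) := by
    by_cases him : i = m
    · subst him
      rw [if_neg (lt_irrefl _), hs]
      simp
      ring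
    · rw [if_pos (by omega), Function.update_of_ne him]
  rw [add_assoc, hc]
  cases i with
  | zero => simp [action]; ring
  | succ i =>
    have : (∑ k ∈ Finset.range (m + 1), if k + 1 = i + 1 then J.a k * freeColumn z j k else 0)
        = J.a i * freeColumn z j i := by
      simp only [Nat.add_right_cancel_iff, Finset.sum_ite_eq', Finset.mem_range]
      rw [if_pos (by omega)]
    simp only [this, action]
    ring

open Polynomial

/-- The rescaled characteristic polynomials `(-2z)ᵐ det (Jₘ - λ(z))` of the sections of `J`, together
with the approximations of the perturbation determinant obtained by replacing the entries of `J` from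
row `m` on with those of `J₀`. -/
noncomputable def sectionPoly (J : JacobiMatrix) : ℕ → ℂ[X] × ℂ[X]
  | 0 => (1, 1)
  | m + 1 =>
    let p := (J.sectionPoly m).1
    let h := (J.sectionPoly m).2
    (X * (X * p) + C (-2 * J.b m) * (X * p) + h,
      h + (C (1 - 4 * J.a m * J.c m) * (X * (X * p)) + C (-2 * J.b m) * (X * p)))

/-- The rescaled characteristic polynomial `(-2z)ᵐ det (Jₘ - λ(z))`. -/
noncomputable def charPoly (J : JacobiMatrix) (m : ℕ) : ℂ[X] := (J.sectionPoly m).1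

/-- The `m`-th polynomial approximation of the perturbation determinant. -/
noncomputable def detApprox (J : JacobiMatrix) (m : ℕ) : ℂ[X] := (J.sectionPoly m).2

/-- The increments of the polynomial approximations of the perturbation determinant. -/
noncomputable def detIncrement (J : JacobiMatrix) (m : ℕ) : ℂ[X] :=
  C (1 - 4 * J.a m * J.c m) * (X * (X * J.charPoly m)) + C (-2 * J.b m) * (X * J.charPoly m)

variable (J : JacobiMatrix)

theorem charPoly_zero : J.charPoly 0 = 1 := rfl

theorem detApprox_zero : J.detApprox 0 = 1 := rfl

theorem charPoly_succ (m : ℕ) : J.charPoly (m + 1) =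
    X * (X * J.charPoly m) + C (-2 * J.b m) * (X * J.charPoly m) + J.detApprox m := rfl

theorem detApprox_succ (m : ℕ) : J.detApprox (m + 1) = J.detApprox m + J.detIncrement m := rfl

theorem detApprox_eq (m : ℕ) :
    J.detApprox m = 1 + ∑ k ∈ Finset.range m, J.detIncrement k := by
  induction m with
  | zero => simp [detApprox_zero]
  | succ m ih => rw [detApprox_succ, ih, Finset.sum_range_succ, add_assoc]

theorem eval_charPoly {z : ℂ} (hz : z ≠ 0) (m : ℕ) : (J.charPoly m).eval z
    = (-2 * z) ^ m * (tridiagonal (fun k => J.b k - joukowski z) J.a J.c m).det := by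
  have hj : -2 * z * joukowski z = -(z ^ 2 + 1) := by
    unfold joukowski
    field_simp
  induction m using Nat.twoStepInduction with
  | zero => simp [charPoly_zero]
  | one =>
    rw [det_tridiagonal_one, charPoly_succ, charPoly_zero, detApprox_zero]
    simp only [eval_add, eval_mul, eval_X, eval_C, eval_one, pow_one]
    linear_combination hj
  | more m ih1 ih2 =>
    have h : (J.charPoly (m + 2)).eval z = (z ^ 2 + 1 - 2 * z * J.b (m + 1)) *
        (J.charPoly (m + 1)).eval z - 4 * J.a m * J.c m * z ^ 2 * (J.charPoly m).eval z := by
      have e := congrArg (eval z) (J.charPoly_succ m)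
      rw [charPoly_succ, detApprox_succ, detIncrement]
      simp only [eval_add, eval_mul, eval_X, eval_C] at e ⊢
      linear_combination -e
    rw [h, ih1, ih2, det_tridiagonal_succ_succ]
    linear_combination ((-2 * z) ^ (m + 1)
      * (tridiagonal (fun k => J.b k - joukowski z) J.a J.c (m + 1)).det) * hj

theorem free_detApprox (m : ℕ) : free.detApprox m = 1 := by
  induction m with
  | zero => rfl
  | succ m ih =>
    rw [detApprox_succ, ih, detIncrement]
    norm_num [free]

theorem eval_detSection {z : ℂ} (hz : z ≠ 0) (m : ℕ) :
    (-2 * z) ^ (m + 1) * (tridiagonal (Function.update (fun k => J.b k - joukowski z) m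
          (J.b m - joukowski z + J.c m * z)) J.a J.c (m + 1)).det
      = (J.detApprox m).eval z
        + ((1 - 2 * J.c m) * z ^ 2 - 2 * J.b m * z) * (J.charPoly m).eval z := by
  rw [det_tridiagonal_update_last (fun k => J.b k - joukowski z), mul_add,
    ← eval_charPoly J hz, charPoly_succ]
  simp only [eval_add, eval_mul, eval_X, eval_C]
  rw [eval_charPoly J hz m]
  ring

theorem det_leadingSection {z : ℂ} (hz : z ≠ 0) (hz1 : ‖z‖ < 1) (m : ℕ) :
    (leadingSection (J.perturbationOp z) (m + 1)).det = (J.detApprox m).eval z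
        + ((1 - 2 * J.c m) * z ^ 2 - 2 * J.b m * z) * (J.charPoly m).eval z := by
  have hfree : leadingSection (free.perturbationOp z) (m + 1) = 1 := by
    have h1 : free.perturbationOp z = 1 := Ring.mul_inverse_cancel _ (isUnit_free_shifted hz hz1)
    ext i j
    rw [h1]
    change (lp.single 2 (j : ℕ) (1 : ℂ) : EllTwo) i = _
    rw [lp.single_apply, Matrix.one_apply]
    simp [Pi.single_apply, Fin.ext_iff]
  have e0 := congrArg Matrix.det (leadingSection_perturbationOp free hz hz1 m)
  rw [hfree, Matrix.det_one, Matrix.det_mul] at e0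
  have e1 := eval_detSection free hz m
  have e2 : (free.detApprox m).eval z
      + ((1 - 2 * free.c m) * z ^ 2 - 2 * free.b m * z) * (free.charPoly m).eval z = 1 := by
    rw [free_detApprox]
    norm_num [free]
  rw [e2] at e1
  rw [leadingSection_perturbationOp J hz hz1, Matrix.det_mul, ← eval_detSection J hz]
  set G := (Matrix.of fun i j : Fin (m + 1) => freeColumn z j i).det
  -- The determinant of the resolvent section does not depend on `J`, so it is read off from the
  -- free case, where the whole section is the identity.
  have hG : G = (-2 * z) ^ (m + 1) := by
    linear_combination (-G) * e1 - ((-2 * z) ^ (m + 1)) * e0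
  rw [hG]
  ring

end JacobiMatrix

/-! ### Moments and coefficient estimates -/

namespace JacobiMatrix

open Polynomial

variable {J : JacobiMatrix}

theorem deviation_nonneg (J : JacobiMatrix) (k : ℕ) : 0 ≤ J.deviation k := by
  unfold deviation
  positivity

theorem moment_nonneg (J : JacobiMatrix) (r : ℕ) : 0 ≤ J.moment r :=
  tsum_nonneg fun k => mul_nonneg (by positivity) (J.deviation_nonneg k)

theorem FiniteMoment.first {n : ℕ} (h : J.FiniteMoment (n + 1)) : J.FiniteMoment 1 := by
  refine Summable.of_nonneg_of_le (fun k => mul_nonneg (by positivity) (J.deviation_nonneg k))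
    (fun k => mul_le_mul_of_nonneg_right ?_ (J.deviation_nonneg k)) h
  exact pow_le_pow_right₀ (by linarith [k.cast_nonneg (α := ℝ)]) (by omega)

theorem FiniteMoment.summable_first (h : J.FiniteMoment 1) :
    Summable fun k : ℕ => ((k : ℝ) + 1) * J.deviation k := by
  simpa [FiniteMoment] using h

theorem moment_one (J : JacobiMatrix) :
    J.moment 1 = ∑' k : ℕ, ((k : ℝ) + 1) * J.deviation k := by
  simp [moment]

theorem deviation_le_moment (h : J.FiniteMoment 1) (k : ℕ) : J.deviation k ≤ J.moment 1 := by
  rw [moment_one]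
  refine le_trans ?_ (h.summable_first.le_tsum k fun i _ =>
    mul_nonneg (by positivity) (J.deviation_nonneg i))
  exact le_mul_of_one_le_left (J.deviation_nonneg k) (by linarith [k.cast_nonneg (α := ℝ)])

theorem moment_one_pos (h : J.FiniteMoment 1) (hJ : J ≠ free) : 0 < J.moment 1 := by
  refine (J.moment_nonneg 1).lt_of_ne fun h0 => hJ ?_
  have hd : ∀ k, ‖J.a k - 1 / 2‖ = 0 ∧ ‖J.b k‖ = 0 ∧ ‖J.c k - 1 / 2‖ = 0 := by
    intro k
    have := deviation_le_moment h k
    rw [← h0, deviation] at this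
    have h1 := norm_nonneg (J.a k - 1 / 2)
    have h2 := norm_nonneg (J.b k)
    have h3 := norm_nonneg (J.c k - 1 / 2)
    refine ⟨?_, ?_, ?_⟩ <;> linarith
  ext k
  · exact sub_eq_zero.1 (norm_eq_zero.1 (hd k).1)
  · exact norm_eq_zero.1 (hd k).2.1
  · exact sub_eq_zero.1 (norm_eq_zero.1 (hd k).2.2)

/-- A Lipschitz constant for the coefficients of the increments of the perturbation determinant. -/
noncomputable def incrementRate (J : JacobiMatrix) : ℝ := 2 + 4 * J.moment 1

theorem incrementRate_pos (J : JacobiMatrix) : 0 < J.incrementRate := by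
  have := J.moment_nonneg 1
  unfold incrementRate
  positivity

theorem norm_increment_coeffs_le (h : J.FiniteMoment 1) (k : ℕ) :
    ‖1 - 4 * J.a k * J.c k‖ + ‖-2 * J.b k‖ ≤ J.incrementRate * J.deviation k := by
  -- The quadratic term is made linear in the deviation by bounding one factor by `M_1`; hence the
  -- rate `2 + 4 M_1`.
  have e : 1 - 4 * J.a k * J.c k = -(4 * (J.a k - 1 / 2) * (J.c k - 1 / 2)
      + 2 * (J.a k - 1 / 2) + 2 * (J.c k - 1 / 2)) := by ring
  have h1 : ‖1 - 4 * J.a k * J.c k‖ ≤ 4 * ‖J.a k - 1 / 2‖ * ‖J.c k - 1 / 2‖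
      + 2 * ‖J.a k - 1 / 2‖ + 2 * ‖J.c k - 1 / 2‖ := by
    rw [e, norm_neg]
    refine norm_add₃_le.trans (le_of_eq ?_)
    simp only [norm_mul, Complex.norm_ofNat]
  have h2 : ‖-2 * J.b k‖ = 2 * ‖J.b k‖ := by simp
  have hd := deviation_le_moment h k
  have ha := norm_nonneg (J.a k - 1 / 2)
  have hb := norm_nonneg (J.b k)
  have hc := norm_nonneg (J.c k - 1 / 2)
  have hM := J.moment_nonneg 1
  unfold incrementRate
  unfold deviation at hd ⊢
  nlinarith [mul_nonneg hM ha, mul_nonneg hM hb,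
    mul_le_mul_of_nonneg_right (show ‖J.a k - 1 / 2‖ ≤ J.moment 1 by linarith) hc]

theorem coeffNorm_detIncrement_le (h : J.FiniteMoment 1) (m : ℕ) :
    coeffNorm (J.detIncrement m)
      ≤ J.incrementRate * J.deviation m * coeffNorm (J.charPoly m) := by
  refine (coeffNorm_add_le _ _).trans ?_
  simp only [coeffNorm_C_mul, coeffNorm_X_mul, ← add_mul]
  exact mul_le_mul_of_nonneg_right (norm_increment_coeffs_le h m) (coeffNorm_nonneg _)

/-- Discrete Gronwall. The two bounds need a joint induction: each step adds one copy of `h_m` to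
`p_m`, whence the factor `m + 1`, and `h_m` grows by `deviation m` times `p_m`; the products of `1 +
x` are absorbed by `1 + x ≤ exp x`. -/
theorem coeffNorm_sectionPoly_le (h : J.FiniteMoment 1) (m : ℕ) :
    coeffNorm (J.charPoly m) ≤ (m + 1) * Real.exp (J.incrementRate *
        ∑ k ∈ Finset.range m, ((k : ℝ) + 1) * J.deviation k) ∧
      coeffNorm (J.detApprox m) ≤ Real.exp (J.incrementRate *
        ∑ k ∈ Finset.range m, ((k : ℝ) + 1) * J.deviation k) := by
  induction m with
  | zero => simp [charPoly_zero, detApprox_zero, coeffNorm_one]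
  | succ m ih =>
    obtain ⟨ih1, ih2⟩ := ih
    rw [Finset.sum_range_succ, mul_add, Real.exp_add]
    set E := Real.exp (J.incrementRate * ∑ k ∈ Finset.range m, ((k : ℝ) + 1) * J.deviation k)
    have hE : 0 < E := Real.exp_pos _
    have hx : E + J.incrementRate * J.deviation m * ((m + 1) * E)
        ≤ E * Real.exp (J.incrementRate * (((m : ℝ) + 1) * J.deviation m)) := by
      nlinarith [mul_le_mul_of_nonneg_left
        (Real.add_one_le_exp (J.incrementRate * (((m : ℝ) + 1) * J.deviation m))) hE.le]
    have hr : 0 ≤ J.incrementRate * J.deviation m :=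
      mul_nonneg J.incrementRate_pos.le (J.deviation_nonneg m)
    have hinc := (coeffNorm_detIncrement_le h m).trans (mul_le_mul_of_nonneg_left ih1 hr)
    constructor
    · have hb : ‖-2 * J.b m‖ ≤ J.incrementRate * J.deviation m :=
        (le_add_of_nonneg_left (norm_nonneg _)).trans (norm_increment_coeffs_le h m)
      have h1 : coeffNorm (J.charPoly (m + 1)) ≤ coeffNorm (J.charPoly m)
          + ‖-2 * J.b m‖ * coeffNorm (J.charPoly m) + coeffNorm (J.detApprox m) := by
        rw [charPoly_succ]
        refine (coeffNorm_add_le _ _).trans (add_le_add_left ((coeffNorm_add_le _ _).trans ?_) _)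
        rw [coeffNorm_C_mul, coeffNorm_X_mul, coeffNorm_X_mul]
      have h2 := mul_le_mul hb ih1 (coeffNorm_nonneg _) hr
      push_cast
      set Y := Real.exp (J.incrementRate * (((m : ℝ) + 1) * J.deviation m))
      have hY : 1 ≤ Y := Real.one_le_exp (by
        have := J.deviation_nonneg m; have := J.incrementRate_pos; positivity)
      have h3 : ((m : ℝ) + 1) * E ≤ ((m : ℝ) + 1) * (E * Y) :=
        mul_le_mul_of_nonneg_left (le_mul_of_one_le_right hE.le hY) (by positivity)
      linarith
    · rw [detApprox_succ]
      exact (coeffNorm_add_le _ _).trans ((add_le_add ih2 hinc).trans hx)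

/-- A bound of the coefficient norms of all the approximations of the perturbation determinant. -/
noncomputable def approxBound (J : JacobiMatrix) : ℝ := Real.exp (J.incrementRate * J.moment 1)

theorem approxBound_pos (J : JacobiMatrix) : 0 < J.approxBound := Real.exp_pos _

theorem coeffNorm_charPoly_le (h : J.FiniteMoment 1) (m : ℕ) :
    coeffNorm (J.charPoly m) ≤ (m + 1) * J.approxBound := by
  refine (coeffNorm_sectionPoly_le h m).1.trans (mul_le_mul_of_nonneg_left ?_ (by positivity))
  refine Real.exp_le_exp.2 (mul_le_mul_of_nonneg_left ?_ J.incrementRate_pos.le)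
  rw [moment_one]
  exact h.summable_first.sum_le_tsum _ fun k _ =>
    mul_nonneg (by positivity) (J.deviation_nonneg k)

theorem coeffNorm_detIncrement_le_deviation (h : J.FiniteMoment 1) (m : ℕ) :
    coeffNorm (J.detIncrement m)
      ≤ J.incrementRate * J.approxBound * ((m + 1) * J.deviation m) := by
  refine (coeffNorm_detIncrement_le h m).trans ((mul_le_mul_of_nonneg_left
    (coeffNorm_charPoly_le h m)
    (mul_nonneg J.incrementRate_pos.le (J.deviation_nonneg m))).trans (le_of_eq ?_))
  ring

theorem natDegree_sectionPoly_le (J : JacobiMatrix) (m : ℕ) :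
    (J.charPoly m).natDegree ≤ 2 * m ∧ (J.detApprox m).natDegree ≤ 2 * m ∧
      (J.detIncrement m).natDegree ≤ 2 * (m + 1) := by
  have hX : ∀ {p : ℂ[X]} {d : ℕ}, p.natDegree ≤ d → (X * p).natDegree ≤ d + 1 := fun {p d} hp =>
    (natDegree_mul_le_of_le natDegree_X_le hp).trans (by omega)
  have hu : ∀ m, (J.charPoly m).natDegree ≤ 2 * m →
      (J.detIncrement m).natDegree ≤ 2 * (m + 1) := fun m hp =>
    natDegree_add_le_of_degree_le ((natDegree_C_mul_le _ _).trans (hX (hX hp)))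
      ((natDegree_C_mul_le _ _).trans ((hX hp).trans (by omega)))
  suffices H : (J.charPoly m).natDegree ≤ 2 * m ∧ (J.detApprox m).natDegree ≤ 2 * m from
    ⟨H.1, H.2, hu m H.1⟩
  induction m with
  | zero => simp [charPoly_zero, detApprox_zero]
  | succ m ih =>
    refine ⟨?_, ?_⟩
    · rw [charPoly_succ]
      exact natDegree_add_le_of_degree_le (natDegree_add_le_of_degree_le (hX (hX ih.1))
        ((natDegree_C_mul_le _ _).trans ((hX ih.1).trans (by omega)))) (ih.2.trans (by omega))
    · rw [detApprox_succ]
      exact natDegree_add_le_of_degree_le (ih.2.trans (by omega)) (hu m ih.1)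

/-- By the degree bound, the weight is at most `(2(m + 1))^n` on the support; the remaining factor
`m + 1` comes from the size of `p_m`. -/
theorem tsum_descFactorial_detIncrement_le (h : J.FiniteMoment 1) (n m : ℕ) :
    ∑' j, (j.descFactorial n : ℝ) * ‖(J.detIncrement m).coeff j‖
      ≤ J.incrementRate * J.approxBound * 2 ^ n * (((m : ℝ) + 1) ^ (n + 1) * J.deviation m) := by
  refine (tsum_weighted_norm_coeff_le _ (W := (2 * ((m : ℝ) + 1)) ^ n)
    (J.natDegree_sectionPoly_le m).2.2 fun j hj => ?_).trans
    ((mul_le_mul_of_nonneg_left (coeffNorm_detIncrement_le_deviation h m)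
      (by positivity)).trans (le_of_eq ?_))
  · have : ((j.descFactorial n : ℕ) : ℝ) ≤ (((2 * (m + 1)) ^ n : ℕ) : ℝ) :=
      Nat.cast_le.2 ((Nat.descFactorial_le_pow j n).trans (Nat.pow_le_pow_left hj n))
    simpa using this
  · rw [mul_pow]
    ring

theorem summable_descFactorial_detIncrement {n : ℕ} (h : J.FiniteMoment (n + 1)) :
    Summable fun q : ℕ × ℕ =>
      (q.2.descFactorial n : ℝ) * ‖(J.detIncrement q.1).coeff q.2‖ := by
  rw [summable_prod_of_nonneg fun q => by positivity]
  have hm : Summable fun m : ℕ => J.incrementRate * J.approxBound * 2 ^ n *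
      (((m : ℝ) + 1) ^ (n + 1) * J.deviation m) := Summable.mul_left _ h
  have hs : Summable fun m => ∑' j, (j.descFactorial n : ℝ) * ‖(J.detIncrement m).coeff j‖ :=
    hm.of_nonneg_of_le (fun m => tsum_nonneg fun j => by positivity)
      (tsum_descFactorial_detIncrement_le h.first n)
  exact ⟨fun m => summable_weighted_norm_coeff (J.detIncrement m) _, hs⟩

theorem tsum_tsum_descFactorial_detIncrement_le {n : ℕ} (h : J.FiniteMoment (n + 1)) :
    ∑' j, ∑' m, (j.descFactorial n : ℝ) * ‖(J.detIncrement m).coeff j‖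
      ≤ J.incrementRate * J.approxBound * 2 ^ n * J.moment (n + 1) := by
  have hs := summable_descFactorial_detIncrement h
  rw [Summable.tsum_comm (f := fun m j =>
    (j.descFactorial n : ℝ) * ‖(J.detIncrement m).coeff j‖) hs, moment, ← tsum_mul_left]
  exact hs.prod.tsum_le_tsum (tsum_descFactorial_detIncrement_le h.first n) (h.mul_left _)

/-! ### Taylor series and identification of the determinant -/

/-- The Taylor coefficients of the perturbation determinant. -/
noncomputable def detCoeff (J : JacobiMatrix) (j : ℕ) : ℂ :=
  (if j = 0 then 1 else 0) + ∑' m, (J.detIncrement m).coeff j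

theorem summable_norm_coeff_detIncrement (h : J.FiniteMoment 1) :
    Summable fun q : ℕ × ℕ => ‖(J.detIncrement q.1).coeff q.2‖ := by
  simpa using summable_descFactorial_detIncrement (n := 0) h

theorem norm_detCoeff_le (h : J.FiniteMoment 1) (n j : ℕ) :
    (j.descFactorial n : ℝ) * ‖J.detCoeff j‖
      ≤ (if j = 0 then (if n = 0 then 1 else 0) else 0)
        + ∑' m, (j.descFactorial n : ℝ) * ‖(J.detIncrement m).coeff j‖ := by
  have hs : Summable fun m => ‖(J.detIncrement m).coeff j‖ :=
    (summable_norm_coeff_detIncrement h).prod_symm.prod_factor j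
  rw [tsum_mul_left]
  refine (mul_le_mul_of_nonneg_left ((norm_add_le _ _).trans
    (add_le_add_right (norm_tsum_le_tsum_norm hs) _)) (by positivity)).trans (le_of_eq ?_)
  rw [mul_add]
  congr 1
  rcases eq_or_ne j 0 with rfl | hj
  · cases n <;> simp
  · simp [hj]

theorem summable_descFactorial_detCoeff {n : ℕ} (h : J.FiniteMoment (n + 1)) :
    (Summable fun j => (j.descFactorial n : ℝ) * ‖J.detCoeff j‖) ∧
      ∑' j, (j.descFactorial n : ℝ) * ‖J.detCoeff j‖ ≤ (if n = 0 then 1 else 0)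
        + J.incrementRate * J.approxBound * 2 ^ n * J.moment (n + 1) := by
  have h1 := hasSum_ite_eq (0 : ℕ) (if n = 0 then (1 : ℝ) else 0)
  have h2 : Summable fun j => ∑' m, (j.descFactorial n : ℝ) * ‖(J.detIncrement m).coeff j‖ :=
    (summable_descFactorial_detIncrement h).prod_symm.prod
  have h3 : Summable fun j => (j.descFactorial n : ℝ) * ‖J.detCoeff j‖ :=
    Summable.of_nonneg_of_le (fun j => by positivity) (norm_detCoeff_le h.first n)
      (h1.summable.add h2)
  refine ⟨h3, (h3.tsum_le_tsum (norm_detCoeff_le h.first n) (h1.summable.add h2)).trans ?_⟩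
  rw [h1.summable.tsum_add h2, h1.tsum_eq]
  exact add_le_add_right (tsum_tsum_descFactorial_detIncrement_le h) _

/-- The limit of the polynomial approximations of the perturbation determinant. -/
noncomputable def detLimit (J : JacobiMatrix) (z : ℂ) : ℂ := 1 + ∑' m, (J.detIncrement m).eval z

theorem summable_eval_detIncrement (h : J.FiniteMoment 1) {z : ℂ} (hz : ‖z‖ ≤ 1) :
    Summable fun m => (J.detIncrement m).eval z :=
  Summable.of_norm_bounded (h.summable_first.mul_left _) fun m =>
    (norm_eval_le_coeffNorm _ hz).trans (coeffNorm_detIncrement_le_deviation h m)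

theorem hasSum_detCoeff (h : J.FiniteMoment 1) {z : ℂ} (hz : ‖z‖ ≤ 1) :
    HasSum (fun j => J.detCoeff j * z ^ j) (J.detLimit z) := by
  have hs : Summable fun q : ℕ × ℕ => (J.detIncrement q.1).coeff q.2 * z ^ q.2 := by
    refine Summable.of_norm_bounded (summable_norm_coeff_detIncrement h) fun q => ?_
    rw [norm_mul, norm_pow]
    exact mul_le_of_le_one_right (norm_nonneg _) (pow_le_one₀ (norm_nonneg _) hz)
  have h1 : HasSum (fun j => ∑' m, (J.detIncrement m).coeff j * z ^ j)
      (∑' m, (J.detIncrement m).eval z) := by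
    have e : ∑' m, (J.detIncrement m).eval z
        = ∑' j, ∑' m, (J.detIncrement m).coeff j * z ^ j := by
      rw [Summable.tsum_comm (f := fun m j => (J.detIncrement m).coeff j * z ^ j) hs]
      exact tsum_congr fun m => (hasSum_eval _ z).tsum_eq.symm
    rw [e]
    exact hs.prod_symm.prod.hasSum
  refine ((hasSum_ite_eq (0 : ℕ) (1 : ℂ)).add h1).congr_fun fun j => ?_
  rw [detCoeff, add_mul, tsum_mul_right]
  rcases eq_or_ne j 0 with rfl | hj <;> simp [*]

theorem tendsto_det_leadingSection (h : J.FiniteMoment 1) {z : ℂ} (hz : z ≠ 0) (hz1 : ‖z‖ < 1) :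
    HasFredholmDet (J.perturbationOp z) (J.detLimit z) := by
  unfold HasFredholmDet
  rw [← tendsto_add_atTop_iff_nat 1]
  simp only [det_leadingSection J hz hz1]
  rw [← add_zero (J.detLimit z)]
  refine Tendsto.add ?_ ?_
  · simp only [detApprox_eq, eval_add, eval_one, eval_finsetSum]
    exact (summable_eval_detIncrement h hz1.le).hasSum.tendsto_sum_nat.const_add 1
  -- The boundary error is at most a constant times `(m + 1) * deviation m`, the general term of a
  -- convergent series.
  · have hlim := (h.summable_first.mul_left (2 * J.approxBound)).tendsto_atTop_zero
    refine squeeze_zero_norm (fun m => ?_) hlim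
    rw [norm_mul]
    have h1 : ‖(1 - 2 * J.c m) * z ^ 2 - 2 * J.b m * z‖ ≤ 2 * J.deviation m := by
      have e : (1 - 2 * J.c m) * z ^ 2 - 2 * J.b m * z
          = -2 * (J.c m - 1 / 2) * z ^ 2 - 2 * J.b m * z := by ring
      have h2 : ‖J.c m - 1 / 2‖ * ‖z‖ ^ 2 ≤ ‖J.c m - 1 / 2‖ :=
        mul_le_of_le_one_right (norm_nonneg _) (pow_le_one₀ (norm_nonneg _) hz1.le)
      have h3 : ‖J.b m‖ * ‖z‖ ≤ ‖J.b m‖ := mul_le_of_le_one_right (norm_nonneg _) hz1.le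
      have h4 := norm_nonneg (J.a m - 1 / 2)
      rw [e]
      refine (norm_sub_le _ _).trans ?_
      simp only [norm_mul, norm_neg, norm_pow, Complex.norm_ofNat, deviation]
      linarith
    refine (mul_le_mul h1 ((norm_eval_le_coeffNorm _ hz1.le).trans (coeffNorm_charPoly_le h m))
      (norm_nonneg _) (mul_nonneg zero_le_two (J.deviation_nonneg m))).trans (le_of_eq ?_)
    ring

/-- Off the origin this is the limit of the sections. At the origin, continuity of `detLimit`
identifies the limit that defines the value. -/
theorem perturbationDet_eq_detLimit (h : J.FiniteMoment 1) {z : ℂ}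
    (hz : z ∈ Metric.ball (0 : ℂ) 1) : J.perturbationDet z = J.detLimit z := by
  have hne : ∀ w : ℂ, w ≠ 0 → ‖w‖ < 1 → fredholmDet (J.perturbationOp w) = J.detLimit w :=
    fun w hw hw1 => (tendsto_det_leadingSection h hw hw1).limUnder_eq
  rcases eq_or_ne z 0 with rfl | hz0
  · rw [perturbationDet, Function.update_self]
    refine Tendsto.limUnder_eq ?_
    have hd : DifferentiableOn ℂ J.detLimit (Metric.ball 0 1) :=
      differentiableOn_ball_of_hasSum (δ := J.detCoeff)
        (by simpa using (summable_descFactorial_detCoeff (n := 0) h).1)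
        fun w hw => hasSum_detCoeff h (mem_ball_zero_iff.1 hw).le
    have hb : Metric.ball (0 : ℂ) 1 ∈ 𝓝 0 := Metric.ball_mem_nhds 0 one_pos
    refine Tendsto.congr' ?_ ((hd.differentiableAt hb).continuousAt.tendsto.mono_left
      nhdsWithin_le_nhds)
    filter_upwards [self_mem_nhdsWithin, mem_nhdsWithin_of_mem_nhds hb] with w hw hw1
    exact (hne w hw (mem_ball_zero_iff.1 hw1)).symm
  · rw [perturbationDet, Function.update_of_ne hz0]
    exact hne z hz0 (mem_ball_zero_iff.1 hz)

end JacobiMatrix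

/-! ### The main bound -/

theorem corollary2p4 (J : JacobiMatrix) :
    ∃ C : ℝ, 0 < C ∧ ∀ n : ℕ, J.FiniteMoment (n + 1) →
      -- the perturbation determinant is well defined and holomorphic in the open disk
      (∀ z : ℂ, z ≠ 0 → ‖z‖ < 1 →
        IsUnit (JacobiMatrix.free.shifted z) ∧
          HasFredholmDet (J.perturbationOp z) (J.perturbationDet z)) ∧
      DifferentiableOn ℂ J.perturbationDet (Metric.ball 0 1) ∧
      -- its derivative of order `n` is in `W₊`
      MemWienerPlus (J.perturbationDetDeriv n) ∧
      -- the bound on the closed disk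
      ((n = 0 → J ≠ JacobiMatrix.free) →
        ∀ z ∈ Metric.closedBall (0 : ℂ) 1,
          ‖J.perturbationDetDeriv n z‖ ≤
            C * ((4 : ℝ) ^ n / ((n : ℝ) + 1)) * J.moment (n + 1)) := by
  have hKB : 0 < J.incrementRate * J.approxBound := mul_pos J.incrementRate_pos J.approxBound_pos
  have hM : 0 ≤ (J.moment 1)⁻¹ := inv_nonneg.2 (J.moment_nonneg 1)
  -- The summand `M_1⁻¹` serves only `n = 0`, where `M_1⁻¹ * M_1 = 1` pays for the constant term of
  -- `Δ`. If `M_1` is zero, or defaults to zero by divergence, the inverse is zero and the constant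
  -- is still positive.
  refine ⟨J.incrementRate * J.approxBound + (J.moment 1)⁻¹, by positivity, fun n hn => ?_⟩
  have h := hn.first
  obtain ⟨hs, hbound⟩ := JacobiMatrix.summable_descFactorial_detCoeff hn
  have hf : ∀ z ∈ Metric.ball (0 : ℂ) 1,
      HasSum (fun j => J.detCoeff j * z ^ j) (J.perturbationDet z) := fun z hz => by
    rw [JacobiMatrix.perturbationDet_eq_detLimit h hz]
    exact JacobiMatrix.hasSum_detCoeff h (mem_ball_zero_iff.1 hz).le
  refine ⟨fun z hz hz1 => ⟨JacobiMatrix.isUnit_free_shifted hz hz1, ?_⟩, ?_,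
    memWienerPlus_extendFrom_iteratedDeriv hs hf, fun hJ z hz =>
      (norm_extendFrom_iteratedDeriv_le hs hf hz).trans (hbound.trans ?_)⟩
  · rw [JacobiMatrix.perturbationDet_eq_detLimit h (mem_ball_zero_iff.2 hz1)]
    exact JacobiMatrix.tendsto_det_leadingSection h hz hz1
  · exact differentiableOn_ball_of_hasSum
      (by simpa using summable_descFactorial_of_le n.zero_le hs) hf
  · rcases eq_or_ne n 0 with rfl | hn0
    · have hpos := JacobiMatrix.moment_one_pos h (hJ rfl)
      have := inv_mul_cancel₀ hpos.ne'
      simp only [if_true, pow_zero, Nat.cast_zero, zero_add, div_one, mul_one, add_mul]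
      linarith
    · rw [if_neg hn0, zero_add]
      refine mul_le_mul_of_nonneg_right ?_ (J.moment_nonneg _)
      -- Equivalent to `n + 1 ≤ 2 ^ n`.
      have h2 : (2 : ℝ) ^ n ≤ 4 ^ n / ((n : ℝ) + 1) := by
        rw [le_div_iff₀ (by positivity), show (4 : ℝ) = 2 * 2 by norm_num, mul_pow]
        refine mul_le_mul_of_nonneg_left ?_ (by positivity)
        exact_mod_cast Nat.succ_le_of_lt n.lt_two_pow_self
      exact mul_le_mul (le_add_of_nonneg_right hM) h2 (by positivity) (by positivity)
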